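/- Let $n \ge 4$, and let $A[D_n]$ be the Artin group of type $D_n$, i.e. the group generated by $t_1,\dots,t_n$ subject to $t_it_jt_i=t_jt_it_j$ if $\{i,j\}$ is one of $\{1,2\},\{2,3\},\dots,\{n-2,n-1\},\{n-2,n\}$, and $t_it_j=t_jt_i$ for all other $i\neq j$. Let $Z(A[D_n])$ be its center and $A_Z[D_n]=A[D_n]/Z(A[D_n])$. Let $\zeta$ and $\chi$ be the automorphisms of $A[D_n]$ defined by $\zeta(t_i)=t_i$ for $1\le i\le n-2$, $\zeta(t_{n-1})=t_n$, $\zeta(t_n)=t_{n-1}$, and $\chi(t_i)=t_i^{-1}$ for $1\le i\le n$, and let $\zeta_Z$ and $\chi_Z$ be the automorphisms of $A_Z[D_n]$ that they induce. Denote by $\mathrm{Inn}(A_Z[D_n])$ the group of inner automorphisms of $A_Z[D_n]$. If $n$ is even, then $\langle\zeta_Z,\chi_Z\rangle\cap\mathrm{Inn}(A_Z[D_n])=\{\mathrm{id}\}$, and if $n$ is odd, then $\langle\chi_Z\rangle\cap\mathrm{Inn}(A_Z[D_n])=\{\mathrm{id}\}$. -/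

import Mathlib

namespace ArtinD

/-- The alternating product `Π(a, b, m) = a * b * a * ⋯` with `m` factors. -/
def altProd {G : Type*} [Group G] (a b : G) : ℕ → G
  | 0 => 1
  | m + 1 => a * altProd b a m

theorem map_altProd {G H : Type*} [Group G] [Group H] (f : G →* H) (m : ℕ) :
    ∀ a b : G, f (altProd a b m) = altProd (f a) (f b) m := by
  induction m with
  | zero => intro a b; simp [altProd]
  | succ m ih => intro a b; simp [altProd, ih]

theorem altProd_succ_right {G : Type*} [Group G] (m : ℕ) :
    ∀ a b : G, altProd a b (m + 1) = altProd a b m * (if Even m then a else b) := by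
  induction m with
  | zero => intro a b; simp [altProd]
  | succ m ih =>
    intro a b
    rw [altProd, ih b a, altProd, ← mul_assoc]
    by_cases h : Even m <;> simp [h, Nat.even_add_one]

theorem altProd_inv {G : Type*} [Group G] (m : ℕ) :
    ∀ a b : G, altProd a⁻¹ b⁻¹ m = (if Even m then altProd b a m else altProd a b m)⁻¹ := by
  induction m with
  | zero => intro a b; simp [altProd]
  | succ m ih =>
    intro a b
    rw [altProd_succ_right, ih a b]
    by_cases h : Even m <;> simp [h, Nat.even_add_one, altProd]

/-- If the braid relation of length `m` holds for `a` and `b`, it holds for their inverses. -/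
theorem altProd_inv_comm {G : Type*} [Group G] {a b : G} {m : ℕ}
    (h : altProd a b m = altProd b a m) : altProd a⁻¹ b⁻¹ m = altProd b⁻¹ a⁻¹ m := by
  rw [altProd_inv, altProd_inv, h]

/-- The defining relators of the Artin group of a Coxeter matrix: `Π(s, t, m) = Π(t, s, m)` for
`s ≠ t` and `m = M s t ≠ ∞`. (In `CoxeterMatrix` the entry `0` encodes `∞`.) -/
def artinRels {S : Type*} (M : CoxeterMatrix S) : Set (FreeGroup S) :=
  {r | ∃ s t : S, s ≠ t ∧ M s t ≠ 0 ∧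
    r = altProd (FreeGroup.of s) (FreeGroup.of t) (M s t) *
      (altProd (FreeGroup.of t) (FreeGroup.of s) (M s t))⁻¹}

/-- The Artin group `⟨S ∣ Π(s, t, M s t) = Π(t, s, M s t), s ≠ t, M s t ≠ ∞⟩`. -/
abbrev ArtinGroup {S : Type*} (M : CoxeterMatrix S) : Type _ := PresentedGroup (artinRels M)

/-- The standard generators of an Artin group. -/
def gen {S : Type*} (M : CoxeterMatrix S) (s : S) : ArtinGroup M := PresentedGroup.of s

theorem gen_rel {S : Type*} (M : CoxeterMatrix S) (s t : S) :
    altProd (gen M s) (gen M t) (M s t) = altProd (gen M t) (gen M s) (M s t) := by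
  by_cases hst : s = t
  · rw [hst]
  by_cases hm : M s t = 0
  · rw [hm]; rfl
  have h : PresentedGroup.mk (artinRels M)
      (altProd (FreeGroup.of s) (FreeGroup.of t) (M s t)) =
      PresentedGroup.mk (artinRels M)
      (altProd (FreeGroup.of t) (FreeGroup.of s) (M s t)) :=
    PresentedGroup.mk_eq_mk_of_mul_inv_mem ⟨s, t, hst, hm, rfl⟩
  rw [map_altProd, map_altProd] at h
  exact h

/-- The homomorphism out of an Artin group with prescribed values on the standard generators. -/
def lift {S : Type*} (M : CoxeterMatrix S) {G : Type*} [Group G] (f : S → G)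
    (hf : ∀ s t, altProd (f s) (f t) (M s t) = altProd (f t) (f s) (M s t)) :
    ArtinGroup M →* G :=
  PresentedGroup.toGroup (f := f) (by
    rintro r ⟨s, t, -, -, rfl⟩
    rw [map_mul, map_inv, map_altProd, map_altProd, FreeGroup.lift_apply_of,
      FreeGroup.lift_apply_of, hf, mul_inv_cancel])

@[simp]
theorem lift_gen {S : Type*} (M : CoxeterMatrix S) {G : Type*} [Group G] (f : S → G)
    (hf : ∀ s t, altProd (f s) (f t) (M s t) = altProd (f t) (f s) (M s t)) (s : S) :
    lift M f hf (gen M s) = f s :=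
  PresentedGroup.toGroup.of _

theorem hom_ext {S : Type*} {M : CoxeterMatrix S} {G : Type*} [Group G]
    {f g : ArtinGroup M →* G} (h : ∀ s, f (gen M s) = g (gen M s)) : f = g :=
  PresentedGroup.ext h

/-- The automorphism of an Artin group sending each standard generator to its inverse. -/
def invAut {S : Type*} (M : CoxeterMatrix S) : MulAut (ArtinGroup M) :=
  let f := lift M (fun s => (gen M s)⁻¹) (fun s t => altProd_inv_comm (gen_rel M s t))
  have hf : f.comp f = MonoidHom.id _ := hom_ext (fun s => by simp [f])
  f.toMulEquiv f hf hf

@[simp]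
theorem invAut_gen {S : Type*} (M : CoxeterMatrix S) (s : S) :
    invAut M (gen M s) = (gen M s)⁻¹ :=
  lift_gen M (fun s => (gen M s)⁻¹) (fun s t => altProd_inv_comm (gen_rel M s t)) s

/-- The automorphism of an Artin group induced by a symmetry of its Coxeter matrix. -/
def permAut {S : Type*} (M : CoxeterMatrix S) (σ : Equiv.Perm S)
    (hσ : ∀ s t, M (σ s) (σ t) = M s t) : MulAut (ArtinGroup M) :=
  have hσ' : ∀ s t, M (σ.symm s) (σ.symm t) = M s t := fun s t => by
    rw [← hσ, σ.apply_symm_apply, σ.apply_symm_apply]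
  let f := lift M (fun s => gen M (σ s)) (fun s t => by rw [← hσ s t]; exact gen_rel M _ _)
  let g := lift M (fun s => gen M (σ.symm s)) (fun s t => by rw [← hσ' s t]; exact gen_rel M _ _)
  f.toMulEquiv g (hom_ext (fun s => by simp [f, g])) (hom_ext (fun s => by simp [f, g]))

@[simp]
theorem permAut_gen {S : Type*} (M : CoxeterMatrix S) (σ : Equiv.Perm S)
    (hσ : ∀ s t, M (σ s) (σ t) = M s t) (s : S) :
    permAut M σ hσ (gen M s) = gen M (σ s) :=
  lift_gen M (fun s => gen M (σ s)) (fun s t => by rw [← hσ s t]; exact gen_rel M _ _) s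

/-- The automorphism of `G ⧸ Z(G)` induced by an automorphism of `G`: `g Z(G) ↦ φ(g) Z(G)`. -/
def modCenter {G : Type*} [Group G] (φ : MulAut G) : MulAut (G ⧸ Subgroup.center G) :=
  QuotientGroup.congr (Subgroup.center G) (Subgroup.center G) φ
    (Subgroup.characteristic_iff_map_eq.1 inferInstance φ)

@[simp]
theorem modCenter_mk {G : Type*} [Group G] (φ : MulAut G) (g : G) :
    modCenter φ (g : G ⧸ Subgroup.center G) = (φ g : G) :=
  rfl

/-- The group of inner automorphisms of `G`. -/
def Inn (G : Type*) [Group G] : Subgroup (MulAut G) := (MulAut.conj : G →* MulAut G).range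

/-- The edges `i — j` with `i < j` of the Coxeter graph `D_n` on the vertices `0, …, n - 1`: the
path `0 — 1 — ⋯ — (n - 2)` together with the edge `(n - 3) — (n - 1)`. The vertex `i` corresponds to
the generator `t_{i+1}`. -/
def EdgeD (n i j : ℕ) : Prop := (i + 1 = j ∧ j + 1 < n) ∨ (i + 3 = n ∧ j + 1 = n)

instance (n i j : ℕ) : Decidable (EdgeD n i j) := by unfold EdgeD; infer_instance

/-- The Coxeter matrix of type `D_n`. (`CoxeterMatrix.D` is not used: it has an additional `3`
between the last two vertices, so its graph contains a triangle.) -/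
def matrixD (n : ℕ) : CoxeterMatrix (Fin n) where
  M := Matrix.of fun i j : Fin n =>
    if i = j then 1 else if EdgeD n i j ∨ EdgeD n j i then 3 else 2
  isSymm := by
    ext i j
    simp only [Matrix.transpose_apply, Matrix.of_apply, eq_comm (a := j), or_comm]
  diagonal i := by simp
  off_diagonal i j h := by simp only [Matrix.of_apply, if_neg h]; split_ifs <;> decide

/-- The transposition of the last two vertices of `D_n`. -/
def swapLast {n : ℕ} (hn : 4 ≤ n) : Equiv.Perm (Fin n) :=
  Equiv.swap ⟨n - 2, by omega⟩ ⟨n - 1, by omega⟩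

theorem matrixD_swapLast {n : ℕ} (hn : 4 ≤ n) (i j : Fin n) :
    matrixD n (swapLast hn i) (swapLast hn j) = matrixD n i j := by
  have key : ∀ i j : Fin n, (EdgeD n i j ∨ EdgeD n j i) →
      EdgeD n (swapLast hn i) (swapLast hn j) ∨ EdgeD n (swapLast hn j) (swapLast hn i) := by
    intro i j
    have := i.2
    have := j.2
    simp only [EdgeD, swapLast, Equiv.swap_apply_def, Fin.ext_iff]
    split_ifs <;> (try dsimp only) <;> omega
  have key2 : (EdgeD n (swapLast hn i) (swapLast hn j) ∨
      EdgeD n (swapLast hn j) (swapLast hn i)) ↔ (EdgeD n i j ∨ EdgeD n j i) := by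
    refine ⟨fun h => ?_, key i j⟩
    simpa [swapLast] using key _ _ h
  simp only [matrixD, Matrix.of_apply, EmbeddingLike.apply_eq_iff_eq, key2]

/-- The Artin group `A[D_n]`. -/
abbrev A (n : ℕ) : Type := ArtinGroup (matrixD n)

/-- The quotient `A_Z[D_n] = A[D_n] / Z(A[D_n])`. -/
abbrev AZ (n : ℕ) : Type := A n ⧸ Subgroup.center (A n)

/-- The automorphism `ζ` of `A[D_n]` exchanging `t_{n-1}` and `t_n` and fixing the other `t_i`. -/
def zeta {n : ℕ} (hn : 4 ≤ n) : MulAut (A n) :=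
  permAut (matrixD n) (swapLast hn) (matrixD_swapLast hn)

/-- The automorphism `χ` of `A[D_n]` sending each `t_i` to its inverse. -/
def chi (n : ℕ) : MulAut (A n) := invAut (matrixD n)

/-- The automorphism `ζ_Z` of `A_Z[D_n]` induced by `ζ`. -/
def zetaZ {n : ℕ} (hn : 4 ≤ n) : MulAut (AZ n) := modCenter (zeta hn)

/-- The automorphism `χ_Z` of `A_Z[D_n]` induced by `χ`. -/
def chiZ (n : ℕ) : MulAut (AZ n) := modCenter (chi n)

end ArtinD

namespace ArtinD

/-! If an automorphism induced on the quotient by the center is inner, then upstairs it is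
conjugation by some `g` up to central factors. The reflection representation with parameter `q`
sends each generator to a matrix of determinant `-q`, and by a Schur argument it sends the center to
scalars `c`.

For `χ`, take determinants at `q = 2`: `(-2)⁻¹ = -2 * c ^ n`, so `c ^ n = 1/4`, and 2-adic valuation
gives `n ∣ 2`, which is impossible.

For `ζ` and `ζχ` with `n` even, the projection to `S_n` sees neither the diagram symmetry nor
inversion, so `g` maps to a central, hence trivial, permutation. At `q = 1` the determinant of the
image of `g` is the sign of that permutation, namely 1. But this image realizes the diagram
symmetry, so its product with the permutation matrix of the swap is a scalar `c`. Then `c ^ n = -1`,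
which no rational `c` satisfies for even `n`.

The induced maps are commuting involutions, so these three cases suffice. -/

open Matrix

/-! ### The reflection representation of the Hecke algebra -/

/-- A generalized Cartan matrix of type `D_n` with parameter `q`. -/
def heckeCartan (n : ℕ) (q : ℚ) : Matrix (Fin n) (Fin n) ℚ := fun i j =>
  if i = j then 1 + q else if EdgeD n i j then -1 else if EdgeD n j i then -q else 0

theorem EdgeD.lt {n i j : ℕ} (h : EdgeD n i j) : i < j := by
  unfold EdgeD at h; omega

theorem heckeCartan_self (n : ℕ) (q : ℚ) (i : Fin n) : heckeCartan n q i i = 1 + q := by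
  simp [heckeCartan]

theorem heckeCartan_mul_of_edge {n : ℕ} (q : ℚ) {i j : Fin n} (h : EdgeD n i j) :
    heckeCartan n q i j * heckeCartan n q j i = q := by
  have h1 : i ≠ j := fun e => by subst e; exact lt_irrefl _ h.lt
  have h2 : ¬ EdgeD n j i := fun e => lt_asymm h.lt e.lt
  simp [heckeCartan, h1, h1.symm, h, h2]

theorem heckeCartan_of_not_edge {n : ℕ} (q : ℚ) {i j : Fin n} (hij : i ≠ j)
    (h : ¬ (EdgeD n i j ∨ EdgeD n j i)) : heckeCartan n q i j = 0 := by
  rw [not_or] at h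
  simp [heckeCartan, hij, h.1, h.2]

/-- The rank one matrix `e_i C_i`, where `C_i` is the `i`-th row of the Cartan matrix. -/
def rankOne (n : ℕ) (q : ℚ) (i : Fin n) : Matrix (Fin n) (Fin n) ℚ :=
  vecMulVec (Pi.single i 1) (heckeCartan n q i)

theorem rankOne_mul (n : ℕ) (q : ℚ) (i j : Fin n) :
    rankOne n q i * rankOne n q j =
      heckeCartan n q i j • vecMulVec (Pi.single i 1) (heckeCartan n q j) := by
  simp [rankOne, vecMulVec_mul_vecMulVec, vecMulVec_smul]

theorem rankOne_mul_self (n : ℕ) (q : ℚ) (i : Fin n) :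
    rankOne n q i * rankOne n q i = (1 + q) • rankOne n q i := by
  rw [rankOne_mul, heckeCartan_self, rankOne]

theorem rankOne_mul_mul (n : ℕ) (q : ℚ) (i j : Fin n) :
    rankOne n q i * rankOne n q j * rankOne n q i =
      (heckeCartan n q i j * heckeCartan n q j i) • rankOne n q i := by
  rw [rankOne_mul, smul_mul_assoc, rankOne, vecMulVec_mul_vecMulVec, vecMulVec_smul, smul_smul]
  simp

/-- By `det (1 - uv) = det (1 - vu)`, the determinant reduces to the scalar `1 - (1 + q)`. -/
theorem det_one_sub_rankOne (n : ℕ) (q : ℚ) (i : Fin n) : (1 - rankOne n q i).det = -q := by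
  have h := det_one_sub_mul_comm (replicateCol Unit (Pi.single i (1 : ℚ)))
    (replicateRow Unit (heckeCartan n q i))
  rw [← vecMulVec_eq] at h
  rw [rankOne, h]
  have hmul : heckeCartan n q i ⬝ᵥ Pi.single i 1 = 1 + q := by
    rw [dotProduct_single, mul_one, heckeCartan_self]
  rw [replicateRow_mul_replicateCol, hmul]
  simp

/-- The Hecke generator `1 - e_i C_i` as an invertible matrix. -/
def heckeGen (n : ℕ) {q : ℚ} (hq : q ≠ 0) (i : Fin n) : (Matrix (Fin n) (Fin n) ℚ)ˣ where
  val := 1 - rankOne n q i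
  inv := 1 - q⁻¹ • rankOne n q i
  val_inv := by
    rw [sub_mul, mul_sub, mul_sub, mul_smul_comm, mul_smul_comm, rankOne_mul_self, smul_smul]
    simp only [one_mul, mul_one]
    match_scalars <;> field_simp; ring
  inv_val := by
    rw [sub_mul, mul_sub, mul_sub, smul_mul_assoc, smul_mul_assoc, rankOne_mul_self, smul_smul]
    simp only [one_mul, mul_one]
    match_scalars <;> field_simp; ring

/-- A map on the vertices of `D_n` satisfies the Artin relations as soon as it satisfies the braid
relations along edges and commutes elsewhere. -/
theorem altProd_matrixD {n : ℕ} {G : Type*} [Group G] (f : Fin n → G)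
    (hedge : ∀ i j : Fin n, EdgeD n i j → f i * f j * f i = f j * f i * f j)
    (hcomm : ∀ i j : Fin n, i ≠ j → ¬ (EdgeD n i j ∨ EdgeD n j i) → f i * f j = f j * f i)
    (i j : Fin n) :
    altProd (f i) (f j) (matrixD n i j) = altProd (f j) (f i) (matrixD n i j) := by
  by_cases hij : i = j
  · rw [hij]
  by_cases h : EdgeD n i j ∨ EdgeD n j i
  · have hM : matrixD n i j = 3 := by
      show (if i = j then 1 else if EdgeD n i j ∨ EdgeD n j i then 3 else 2) = 3
      rw [if_neg hij, if_pos h]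
    rw [hM]
    simp only [altProd, mul_one, ← mul_assoc]
    rcases h with h | h
    · exact hedge i j h
    · exact (hedge j i h).symm
  · have hM : matrixD n i j = 2 := by
      show (if i = j then 1 else if EdgeD n i j ∨ EdgeD n j i then 3 else 2) = 2
      rw [if_neg hij, if_neg h]
    rw [hM]
    simpa [altProd] using hcomm i j hij h

theorem heckeGen_braid (n : ℕ) {q : ℚ} (hq : q ≠ 0) (i j : Fin n) (h : EdgeD n i j) :
    heckeGen n hq i * heckeGen n hq j * heckeGen n hq i =
      heckeGen n hq j * heckeGen n hq i * heckeGen n hq j := by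
  ext1
  simp only [Units.val_mul, heckeGen]
  -- The linear terms in `a` beyond the first cancel, since `-1 + (1 + q) - q = 0`. What remains is
  -- symmetric in `a` and `b`.
  have key : ∀ a b : Matrix (Fin n) (Fin n) ℚ, a * a = (1 + q) • a → a * b * a = q • a →
      (1 - a) * (1 - b) * (1 - a) = 1 - a - b + a * b + b * a := by
    intro a b h1 h2
    have : (1 - a) * (1 - b) * (1 - a) =
        1 - a - b - a + a * a + a * b + b * a - a * b * a := by noncomm_ring
    rw [this, h1, h2]
    module
  rw [key _ _ (rankOne_mul_self n q i)
      (by rw [rankOne_mul_mul, heckeCartan_mul_of_edge q h]),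
    key _ _ (rankOne_mul_self n q j)
      (by rw [rankOne_mul_mul, mul_comm, heckeCartan_mul_of_edge q h])]
  abel

theorem heckeGen_comm (n : ℕ) {q : ℚ} (hq : q ≠ 0) (i j : Fin n) (hij : i ≠ j)
    (h : ¬ (EdgeD n i j ∨ EdgeD n j i)) :
    heckeGen n hq i * heckeGen n hq j = heckeGen n hq j * heckeGen n hq i := by
  ext1
  simp only [Units.val_mul, heckeGen]
  have h1 : rankOne n q i * rankOne n q j = 0 := by
    rw [rankOne_mul, heckeCartan_of_not_edge q hij h, zero_smul]
  have h2 : rankOne n q j * rankOne n q i = 0 := by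
    rw [rankOne_mul, heckeCartan_of_not_edge q hij.symm (by rwa [or_comm]), zero_smul]
  rw [sub_mul, sub_mul, mul_sub, mul_sub, mul_sub, mul_sub, h1, h2]
  simp only [one_mul, mul_one]
  abel

/-- The reflection representation of `A[D_n]` with parameter `q`. -/
def heckeRep (n : ℕ) {q : ℚ} (hq : q ≠ 0) : A n →* (Matrix (Fin n) (Fin n) ℚ)ˣ :=
  lift (matrixD n) (heckeGen n hq)
    (altProd_matrixD _ (heckeGen_braid n hq) (heckeGen_comm n hq))

@[simp]
theorem heckeRep_gen (n : ℕ) {q : ℚ} (hq : q ≠ 0) (i : Fin n) :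
    heckeRep n hq (gen (matrixD n) i) = heckeGen n hq i :=
  lift_gen ..

/-- A matrix commuting with all reflections is scalar, as the graph `D_n` is connected. -/
theorem exists_eq_smul_one_of_commute {n : ℕ} (hn : 4 ≤ n) {q : ℚ} (hq : q ≠ 0) (hq' : 1 + q ≠ 0)
    {X : Matrix (Fin n) (Fin n) ℚ}
    (hX : ∀ i, X * (heckeGen n hq i : Matrix (Fin n) (Fin n) ℚ) = (heckeGen n hq i).val * X) :
    ∃ c : ℚ, X = c • (1 : Matrix (Fin n) (Fin n) ℚ) := by
  -- Entry `(k, l)` of `X e_i C_i = e_i C_i X`. Taking `l = i` kills the off-diagonal entries of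
  -- `X`; taking `k = i` along an edge equates two diagonal entries.
  have hcomm : ∀ i k l, X k i * heckeCartan n q i l =
      (Pi.single i 1 : Fin n → ℚ) k * (heckeCartan n q i ᵥ* X) l := by
    intro i k l
    have h := hX i
    simp only [heckeGen, mul_sub, sub_mul, mul_one, one_mul, sub_right_inj] at h
    rw [rankOne, mul_vecMulVec, vecMulVec_mul] at h
    simpa [vecMulVec_apply] using congrFun (congrFun h k) l
  have hoff : ∀ i k, k ≠ i → X k i = 0 := by
    intro i k hk
    have h := hcomm i k i
    rw [Pi.single_eq_of_ne hk, zero_mul, heckeCartan_self] at h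
    exact (mul_eq_zero.mp h).resolve_right hq'
  have hedge : ∀ i l : Fin n, EdgeD n i l → X i i = X l l := by
    intro i l hil
    have h := hcomm i i l
    have hsum : (heckeCartan n q i ᵥ* X) l = heckeCartan n q i l * X l l := by
      rw [vecMul, dotProduct, Finset.sum_eq_single l]
      · intro k _ hk
        rw [hoff l k hk, mul_zero]
      · simp
    rw [hsum, Pi.single_eq_same, one_mul, mul_comm] at h
    refine mul_left_cancel₀ (fun h0 => hq ?_) h
    rw [← heckeCartan_mul_of_edge q hil, h0, zero_mul]
  have hpath : ∀ k (hk : k + 1 < n), X ⟨k, by omega⟩ ⟨k, by omega⟩ =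
      X ⟨0, by omega⟩ ⟨0, by omega⟩ := by
    intro k
    induction k with
    | zero => intro _; rfl
    | succ k ih =>
      intro hk
      rw [← ih (by omega)]
      exact (hedge _ _ (Or.inl ⟨rfl, hk⟩)).symm
  have hdiag : ∀ i : Fin n, X i i = X ⟨0, by omega⟩ ⟨0, by omega⟩ := by
    intro i
    by_cases hi : (i : ℕ) + 1 < n
    · exact hpath i hi
    -- The last vertex lies off the path and is joined to `n - 3`.
    · rw [← hpath (n - 3) (by omega)]
      exact (hedge _ _ (Or.inr ⟨by simp; omega, by omega⟩)).symm
  refine ⟨X ⟨0, by omega⟩ ⟨0, by omega⟩, ?_⟩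
  ext k i
  by_cases hk : k = i
  · subst hk; simp [hdiag k]
  · simp [hoff i k hk, one_apply_ne hk]

theorem exists_heckeRep_eq_smul_one {n : ℕ} (hn : 4 ≤ n) {q : ℚ} (hq : q ≠ 0) (hq' : 1 + q ≠ 0)
    {z : A n} (hz : z ∈ Subgroup.center (A n)) :
    ∃ c : ℚ, (heckeRep n hq z : Matrix (Fin n) (Fin n) ℚ) = c • 1 := by
  refine exists_eq_smul_one_of_commute hn hq hq' fun i => ?_
  rw [← heckeRep_gen, ← Units.val_mul, ← Units.val_mul, ← map_mul, ← map_mul,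
    Subgroup.mem_center_iff.mp hz]

/-! ### The projection to the symmetric group -/

/-- The adjacent transposition attached to a vertex of `D_n`. The last two vertices both give
the transposition of the last two points. -/
def permGen {n : ℕ} (hn : 4 ≤ n) (i : Fin n) : Equiv.Perm (Fin n) :=
  Equiv.swap ⟨min (i : ℕ) (n - 2), by omega⟩ ⟨min (i : ℕ) (n - 2) + 1, by omega⟩

theorem permGen_braid {n : ℕ} (hn : 4 ≤ n) (i j : Fin n) (h : EdgeD n i j) :
    permGen hn i * permGen hn j * permGen hn i = permGen hn j * permGen hn i * permGen hn j := by
  have hj : min (j : ℕ) (n - 2) = min (i : ℕ) (n - 2) + 1 := by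
    unfold EdgeD at h; omega
  have hj' : min (j : ℕ) (n - 2) + 1 < n := by omega
  simp only [permGen, hj] at hj' ⊢
  have hbc : (⟨min (i : ℕ) (n - 2) + 1, by omega⟩ : Fin n) ≠ ⟨min (i : ℕ) (n - 2) + 1 + 1, hj'⟩ := by
    simp
  have hac : (⟨min (i : ℕ) (n - 2), by omega⟩ : Fin n) ≠ ⟨min (i : ℕ) (n - 2) + 1 + 1, hj'⟩ := by
    simp; omega
  have hab : (⟨min (i : ℕ) (n - 2), by omega⟩ : Fin n) ≠ ⟨min (i : ℕ) (n - 2) + 1, by omega⟩ := by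
    simp
  generalize (⟨min (i : ℕ) (n - 2), _⟩ : Fin n) = a at *
  generalize (⟨min (i : ℕ) (n - 2) + 1, _⟩ : Fin n) = b at *
  generalize (⟨min (i : ℕ) (n - 2) + 1 + 1, _⟩ : Fin n) = c at *
  rw [Equiv.swap_mul_swap_mul_swap hab hac, Equiv.swap_comm a b, Equiv.swap_comm b c,
    Equiv.swap_mul_swap_mul_swap hbc.symm hac.symm, Equiv.swap_comm]

theorem permGen_comm {n : ℕ} (hn : 4 ≤ n) (i j : Fin n)
    (h : ¬ (EdgeD n i j ∨ EdgeD n j i)) :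
    permGen hn i * permGen hn j = permGen hn j * permGen hn i := by
  -- The last two vertices are not joined and share a transposition. In the remaining case the two
  -- transpositions are disjoint.
  by_cases hm : min (i : ℕ) (n - 2) = min (j : ℕ) (n - 2)
  · simp only [permGen, hm]
  have hlt := i.2
  have hlt' := j.2
  unfold EdgeD at h
  unfold permGen
  rw [Equiv.mul_swap_eq_swap_mul, Equiv.swap_apply_of_ne_of_ne, Equiv.swap_apply_of_ne_of_ne] <;>
    (rw [Ne, Fin.mk.injEq]; omega)

/-- The projection `A[D_n] → S_n`. -/
def permRep {n : ℕ} (hn : 4 ≤ n) : A n →* Equiv.Perm (Fin n) :=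
  lift (matrixD n) (permGen hn) (altProd_matrixD _ (permGen_braid hn)
    fun i j _ => permGen_comm hn i j)

@[simp]
theorem permRep_gen {n : ℕ} (hn : 4 ≤ n) (i : Fin n) :
    permRep hn (gen (matrixD n) i) = permGen hn i :=
  lift_gen ..

theorem permGen_swapLast {n : ℕ} (hn : 4 ≤ n) (i : Fin n) :
    permGen hn (swapLast hn i) = permGen hn i := by
  have : min (swapLast hn i : ℕ) (n - 2) = min (i : ℕ) (n - 2) := by
    simp only [swapLast, Equiv.swap_apply_def, Fin.ext_iff]
    split_ifs <;> simp <;> omega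
  simp only [permGen, this]

/-- A permutation commuting with all adjacent transpositions is trivial. -/
theorem eq_one_of_commute_permGen {n : ℕ} (hn : 4 ≤ n) {p : Equiv.Perm (Fin n)}
    (hp : ∀ i, p * permGen hn i = permGen hn i * p) : p = 1 := by
  obtain ⟨m, rfl⟩ : ∃ m, n = m + 1 := ⟨n - 1, by omega⟩
  have hall : ∀ s : Equiv.Perm (Fin (m + 1)), s * p = p * s := by
    have hle : Submonoid.closure (Set.range fun i : Fin m => Equiv.swap i.castSucc i.succ) ≤
        Submonoid.centralizer {p} := by
      rw [Submonoid.closure_le]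
      rintro _ ⟨i, rfl⟩
      have h := hp i.castSucc
      have hi : min (i : ℕ) (m + 1 - 2) = i := by omega
      have hg : permGen hn i.castSucc = Equiv.swap i.castSucc i.succ := by
        simp only [permGen, Fin.val_castSucc, hi]
        rfl
      rw [hg] at h
      rw [SetLike.mem_coe, Submonoid.mem_centralizer_iff]
      rintro _ rfl
      exact h
    rw [Equiv.Perm.mclosure_swap_castSucc_succ] at hle
    intro s
    have := hle (Submonoid.mem_top s)
    rw [Submonoid.mem_centralizer_iff] at this
    exact (this p rfl).symm
  ext1 a
  by_contra ha
  rw [Equiv.Perm.one_apply] at ha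
  -- If `p` moves `a`, the swap of `p a` with a third point `b` fixes `a`, so commuting with it
  -- would force `p a = b`.
  obtain ⟨b, hb⟩ : ∃ b, b ∉ ({a, p a} : Finset (Fin (m + 1))) := by
    by_contra! hcon
    have h1 := Finset.card_le_card (fun x _ => hcon x : Finset.univ ⊆ {a, p a})
    have h2 := Finset.card_le_two (a := a) (b := p a)
    simp at h1
    omega
  simp only [Finset.mem_insert, Finset.mem_singleton, not_or] at hb
  have h := Equiv.congr_fun (hall (Equiv.swap (p a) b)) a
  simp only [Equiv.Perm.mul_apply, Equiv.swap_apply_left] at h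
  rw [Equiv.swap_apply_of_ne_of_ne (Ne.symm ha) (Ne.symm hb.1)] at h
  exact hb.2 h

theorem permRep_center {n : ℕ} (hn : 4 ≤ n) {z : A n} (hz : z ∈ Subgroup.center (A n)) :
    permRep hn z = 1 :=
  eq_one_of_commute_permGen hn fun i => by
    rw [← permRep_gen, ← map_mul, ← map_mul, Subgroup.mem_center_iff.mp hz]

/-- Both sides are characters with value `-1` on every generator. -/
theorem sign_permRep {n : ℕ} (hn : 4 ≤ n) (g : A n) :
    ((Equiv.Perm.sign (permRep hn g) : ℤ) : ℚ) =
      (heckeRep n one_ne_zero g : Matrix (Fin n) (Fin n) ℚ).det := by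
  have h : (Units.map (Int.castRingHom ℚ).toMonoidHom).comp
        (Equiv.Perm.sign.comp (permRep hn)) =
      (Units.map (detMonoidHom (R := ℚ) (n := Fin n))).comp (heckeRep n one_ne_zero) := by
    refine hom_ext fun i => ?_
    ext1
    have hne : (⟨min (i : ℕ) (n - 2), by omega⟩ : Fin n) ≠ ⟨min (i : ℕ) (n - 2) + 1, by omega⟩ := by simp
    simp [permGen, Equiv.Perm.sign_swap hne, heckeGen, det_one_sub_rankOne]
  simpa using congrArg Units.val (DFunLike.congr_fun h g)

/-! ### Automorphisms modulo the center -/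

theorem modCenter_mul {G : Type*} [Group G] (φ ψ : MulAut G) :
    modCenter (φ * ψ) = modCenter φ * modCenter ψ := by
  ext x
  induction x using QuotientGroup.induction_on with
  | H g => rfl

theorem modCenter_one {G : Type*} [Group G] : modCenter (1 : MulAut G) = 1 := by
  ext x
  induction x using QuotientGroup.induction_on with
  | H g => rfl

theorem exists_conj_mul_of_modCenter_mem_Inn {G : Type*} [Group G] {φ : MulAut G}
    (h : modCenter φ ∈ Inn (G ⧸ Subgroup.center G)) :
    ∃ g : G, ∀ a : G, ∃ z ∈ Subgroup.center G, φ a = g * a * g⁻¹ * z := by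
  obtain ⟨x, hx⟩ := h
  induction x using QuotientGroup.induction_on with
  | H g =>
    refine ⟨g, fun a => ⟨(g * a * g⁻¹)⁻¹ * φ a, ?_, by group⟩⟩
    rw [← QuotientGroup.eq]
    exact DFunLike.congr_fun hx (a : G ⧸ Subgroup.center G)

theorem chi_gen {n : ℕ} (i : Fin n) : chi n (gen (matrixD n) i) = (gen (matrixD n) i)⁻¹ :=
  invAut_gen ..

theorem zeta_gen {n : ℕ} (hn : 4 ≤ n) (i : Fin n) :
    zeta hn (gen (matrixD n) i) = gen (matrixD n) (swapLast hn i) :=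
  permAut_gen ..

theorem mulAut_ext {n : ℕ} {φ ψ : MulAut (A n)}
    (h : ∀ i, φ (gen (matrixD n) i) = ψ (gen (matrixD n) i)) : φ = ψ :=
  MulEquiv.toMonoidHom_injective (hom_ext h)

theorem chi_mul_chi (n : ℕ) : chi n * chi n = 1 :=
  mulAut_ext fun i => by simp [chi_gen]

theorem zeta_mul_zeta {n : ℕ} (hn : 4 ≤ n) : zeta hn * zeta hn = 1 :=
  mulAut_ext fun i => by simp [zeta_gen, swapLast]

theorem chi_mul_zeta {n : ℕ} (hn : 4 ≤ n) : chi n * zeta hn = zeta hn * chi n :=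
  mulAut_ext fun i => by simp [zeta_gen, chi_gen]

theorem chiZ_notMem_Inn {n : ℕ} (hn : 4 ≤ n) : chiZ n ∉ Inn (AZ n) := by
  intro h
  obtain ⟨g, hg⟩ := exists_conj_mul_of_modCenter_mem_Inn h
  obtain ⟨z, hz, he⟩ := hg (gen (matrixD n) ⟨0, by omega⟩)
  have h2 : (2 : ℚ) ≠ 0 := two_ne_zero
  obtain ⟨c, hc⟩ := exists_heckeRep_eq_smul_one hn h2 (by norm_num) hz
  have hdet := congrArg (fun x => (Units.map (detMonoidHom (R := ℚ) (n := Fin n)))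
    (heckeRep n h2 x)) he
  simp only [chi_gen, map_mul, map_inv, mul_inv_cancel_comm] at hdet
  have hdet := congrArg Units.val hdet
  have hgen : ((Units.map (detMonoidHom (R := ℚ) (n := Fin n)))
      (heckeGen n h2 ⟨0, by omega⟩) : ℚ) = -2 := det_one_sub_rankOne n 2 _
  have hz : ((Units.map (detMonoidHom (R := ℚ) (n := Fin n))) (heckeRep n h2 z) : ℚ) = c ^ n := by
    simp [hc]
  rw [heckeRep_gen, Units.val_mul, Units.val_inv_eq_inv_val, hgen, hz] at hdet
  have hcn : c ^ n = (2 : ℚ) ^ (-2 : ℤ) := by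
    rw [_root_.zpow_neg]; norm_num; linarith
  have hv := congrArg (padicValRat 2) hcn
  rw [padicValRat.pow, padicValRat.zpow] at hv
  have h22 : padicValRat 2 (2 : ℚ) = 1 := by exact_mod_cast padicValRat.self (p := 2) one_lt_two
  rw [h22] at hv
  -- The valuation of `c ^ n = 1/4` reads `n * v(c) = -2`.
  have hdvd : (n : ℤ) ∣ 2 := ⟨-padicValRat 2 c, by linarith⟩
  have := Int.le_of_dvd two_pos hdvd
  omega

/-! ### The diagram symmetry in the reflection representation at `q = 1` -/

theorem heckeCartan_one_swapLast {n : ℕ} (hn : 4 ≤ n) (i j : Fin n) :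
    heckeCartan n 1 (swapLast hn i) (swapLast hn j) = heckeCartan n 1 i j := by
  have key : ∀ i j : Fin n, heckeCartan n 1 i j =
      if matrixD n i j = 1 then 2 else if matrixD n i j = 3 then -1 else 0 := by
    intro i j
    have hM : matrixD n i j = if i = j then 1 else if EdgeD n i j ∨ EdgeD n j i then 3 else 2 := rfl
    rw [hM, heckeCartan]
    by_cases h1 : i = j <;> by_cases h2 : EdgeD n i j <;> by_cases h3 : EdgeD n j i <;>
      norm_num [h1, h2, h3]
  rw [key, key, matrixD_swapLast]

theorem swapLast_swapLast {n : ℕ} (hn : 4 ≤ n) (i : Fin n) :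
    swapLast hn (swapLast hn i) = i :=
  Equiv.swap_apply_self ..

theorem permMatrix_mul_heckeGen {n : ℕ} (hn : 4 ≤ n) (i : Fin n) :
    (swapLast hn).permMatrix ℚ * (heckeGen n one_ne_zero (swapLast hn i)).val =
      (heckeGen n one_ne_zero i).val * (swapLast hn).permMatrix ℚ := by
  have hsymm : (swapLast hn).symm = swapLast hn := Equiv.symm_swap ..
  rw [Equiv.Perm.permMatrix, PEquiv.toMatrix_toPEquiv_mul, PEquiv.mul_toMatrix_toPEquiv, hsymm]
  ext k l
  have h := heckeCartan_one_swapLast hn i (swapLast hn l)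
  rw [swapLast_swapLast] at h
  have hk : swapLast hn k = l ↔ k = swapLast hn l := by
    constructor
    · rintro rfl; rw [swapLast_swapLast]
    · rintro rfl; rw [swapLast_swapLast]
  simp [heckeGen, rankOne, vecMulVec_apply, one_apply, Pi.single_apply, h, hk]

theorem heckeGen_one_inv (n : ℕ) (i : Fin n) :
    (heckeGen n one_ne_zero i)⁻¹ = heckeGen n (one_ne_zero (α := ℚ)) i := by
  ext1
  change 1 - (1 : ℚ)⁻¹ • rankOne n 1 i = 1 - rankOne n 1 i
  rw [inv_one, one_smul]

theorem trace_heckeGen_one (n : ℕ) (i : Fin n) :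
    (heckeGen n (one_ne_zero (α := ℚ)) i).val.trace = n - 2 := by
  change (1 - rankOne n 1 i).trace = n - 2
  rw [trace_sub, trace_one, Fintype.card_fin, rankOne, trace_vecMulVec, single_dotProduct,
    heckeCartan_self]
  norm_num

/-- For even `n`, an automorphism of `A[D_n]` that acts as the diagram symmetry up to inversion of
the generators is not inner modulo the center. -/
theorem modCenter_notMem_Inn_of_swapLast {n : ℕ} (hn : 4 ≤ n) (heven : Even n) {φ : MulAut (A n)}
    (hφ : ∀ i, φ (gen (matrixD n) i) = gen (matrixD n) (swapLast hn i) ∨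
      φ (gen (matrixD n) i) = (gen (matrixD n) (swapLast hn i))⁻¹) :
    modCenter φ ∉ Inn (AZ n) := by
  intro h
  obtain ⟨g, hg⟩ := exists_conj_mul_of_modCenter_mem_Inn h
  have hperm : permRep hn g = 1 := by
    refine eq_one_of_commute_permGen hn fun i => ?_
    obtain ⟨z, hz, he⟩ := hg (gen (matrixD n) i)
    have hφi : permRep hn (φ (gen (matrixD n) i)) = permGen hn i := by
      rcases hφ i with h | h
      · rw [h, permRep_gen, permGen_swapLast]
      · rw [h, map_inv, permRep_gen, permGen_swapLast, permGen, Equiv.swap_inv]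
    rw [he, map_mul, permRep_center hn hz, mul_one, map_mul, map_mul, map_inv, permRep_gen,
      mul_inv_eq_iff_eq_mul] at hφi
    exact hφi
  have hconj : ∀ i, (heckeRep n one_ne_zero g).val * (heckeGen n one_ne_zero i).val =
      (heckeGen n one_ne_zero (swapLast hn i)).val * (heckeRep n one_ne_zero g).val := by
    intro i
    obtain ⟨z, hz, he⟩ := hg (gen (matrixD n) i)
    have hφi : heckeRep n one_ne_zero (φ (gen (matrixD n) i)) =
        heckeGen n one_ne_zero (swapLast hn i) := by
      rcases hφ i with h | h
      · rw [h, heckeRep_gen]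
      · rw [h, map_inv, heckeRep_gen, heckeGen_one_inv]
    obtain ⟨c, hc⟩ := exists_heckeRep_eq_smul_one hn one_ne_zero (by norm_num) hz
    rw [he, map_mul, map_mul, map_mul, map_inv, heckeRep_gen] at hφi
    have hval := congrArg Units.val hφi
    rw [Units.val_mul, hc, mul_smul_comm, mul_one] at hval
    -- Reflections all have trace `n - 2 ≠ 0`, and trace is conjugation invariant, so the central
    -- scalar is 1.
    have htr := congrArg trace hval
    rw [trace_smul, Units.val_mul, Units.val_mul, trace_mul_cycle, Units.inv_mul, one_mul,
      trace_heckeGen_one, trace_heckeGen_one, smul_eq_mul] at htr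
    have hn2 : (n : ℚ) - 2 ≠ 0 := by
      have : (4 : ℚ) ≤ n := by exact_mod_cast hn
      intro h0
      linarith
    have hc1 : c = 1 := mul_right_cancel₀ hn2 (by rw [htr, one_mul])
    rw [hc1, one_smul] at hval
    rw [← hval, ← Units.val_mul, ← Units.val_mul, inv_mul_cancel_right]
  obtain ⟨c, hc⟩ := exists_eq_smul_one_of_commute hn one_ne_zero (by norm_num)
    (X := (swapLast hn).permMatrix ℚ * (heckeRep n one_ne_zero g).val) fun i => by
      rw [Matrix.mul_assoc, hconj, ← Matrix.mul_assoc, permMatrix_mul_heckeGen, Matrix.mul_assoc]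
  have hdet := congrArg det hc
  have hne : (⟨n - 2, by omega⟩ : Fin n) ≠ ⟨n - 1, by omega⟩ := by
    rw [Ne, Fin.mk.injEq]; omega
  rw [det_mul, ← sign_permRep hn, hperm, det_permutation, swapLast, Equiv.Perm.sign_swap hne,
    det_smul, det_one, Fintype.card_fin] at hdet
  -- The determinant identity is now `-1 = c ^ n`; parity of `n` enters only here.
  have hpos := heven.pow_nonneg c
  norm_num at hdet
  linarith

/-! ### Subgroups generated by commuting involutions -/

theorem eq_zpow_mul_zpow_of_mem_closure_pair {G : Type*} [Group G] {a b x : G} (hab : Commute a b)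
    (hx : x ∈ Subgroup.closure {a, b}) : ∃ k l : ℤ, x = a ^ k * b ^ l := by
  induction hx using Subgroup.closure_induction with
  | mem x hx =>
    rcases hx with rfl | rfl
    · exact ⟨1, 0, by simp⟩
    · exact ⟨0, 1, by simp⟩
  | one => exact ⟨0, 0, by simp⟩
  | mul x y _ _ hx hy =>
    obtain ⟨k, l, rfl⟩ := hx
    obtain ⟨k', l', rfl⟩ := hy
    refine ⟨k + k', l + l', ?_⟩
    rw [_root_.zpow_add, _root_.zpow_add, mul_assoc, ← mul_assoc (b ^ l), ← (hab.zpow_zpow k' l).eq]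
    simp only [mul_assoc]
  | inv x _ hx =>
    obtain ⟨k, l, rfl⟩ := hx
    exact ⟨-k, -l, by rw [(hab.zpow_zpow k l).eq, _root_.mul_inv_rev, _root_.zpow_neg, _root_.zpow_neg]⟩

theorem zpow_eq_one_or_self {G : Type*} [Group G] {a : G} (ha : a * a = 1) (k : ℤ) :
    a ^ k = 1 ∨ a ^ k = a := by
  rcases Int.even_or_odd' k with ⟨m, rfl | rfl⟩
  · left; rw [_root_.zpow_mul, _root_.zpow_two, ha, _root_.one_zpow]
  · right; rw [_root_.zpow_add_one, _root_.zpow_mul, _root_.zpow_two, ha, _root_.one_zpow, one_mul]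

theorem chiZ_mul_chiZ (n : ℕ) : chiZ n * chiZ n = 1 := by
  rw [chiZ, ← modCenter_mul, chi_mul_chi, modCenter_one]

theorem zetaZ_mul_zetaZ {n : ℕ} (hn : 4 ≤ n) : zetaZ hn * zetaZ hn = 1 := by
  rw [zetaZ, ← modCenter_mul, zeta_mul_zeta, modCenter_one]

theorem commute_zetaZ_chiZ {n : ℕ} (hn : 4 ≤ n) : Commute (zetaZ hn) (chiZ n) := by
  rw [Commute, SemiconjBy, zetaZ, chiZ, ← modCenter_mul, ← modCenter_mul, chi_mul_zeta]

end ArtinD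

theorem lemmaA6 (n : ℕ) (hn : 4 ≤ n) :
    (Even n →
      Subgroup.closure {ArtinD.zetaZ hn, ArtinD.chiZ n} ⊓ ArtinD.Inn (ArtinD.AZ n) = ⊥) ∧
    (Odd n →
      Subgroup.closure {ArtinD.chiZ n} ⊓ ArtinD.Inn (ArtinD.AZ n) = ⊥) := by
  refine ⟨fun heven => ?_, fun _ => ?_⟩
  · rw [eq_bot_iff]
    rintro x ⟨hx, hinn⟩
    obtain ⟨k, l, rfl⟩ :=
      ArtinD.eq_zpow_mul_zpow_of_mem_closure_pair (ArtinD.commute_zetaZ_chiZ hn) hx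
    have hzeta : ArtinD.zetaZ hn ∉ ArtinD.Inn (ArtinD.AZ n) :=
      ArtinD.modCenter_notMem_Inn_of_swapLast hn heven fun i => Or.inl (ArtinD.zeta_gen hn i)
    have hprod : ArtinD.zetaZ hn * ArtinD.chiZ n ∉ ArtinD.Inn (ArtinD.AZ n) := by
      rw [ArtinD.zetaZ, ArtinD.chiZ, ← ArtinD.modCenter_mul]
      refine ArtinD.modCenter_notMem_Inn_of_swapLast hn heven fun i => Or.inr ?_
      rw [MulAut.mul_apply, ArtinD.chi_gen, map_inv, ArtinD.zeta_gen]
    rcases ArtinD.zpow_eq_one_or_self (ArtinD.zetaZ_mul_zetaZ hn) k with hk | hk <;>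
      rcases ArtinD.zpow_eq_one_or_self (ArtinD.chiZ_mul_chiZ n) l with hl | hl <;>
      simp only [hk, hl, one_mul, mul_one] at hinn ⊢
    · exact Subgroup.mem_bot.mpr rfl
    · exact absurd hinn (ArtinD.chiZ_notMem_Inn hn)
    · exact absurd hinn hzeta
    · exact absurd hinn hprod
  · rw [eq_bot_iff]
    rintro x ⟨hx, hinn⟩
    obtain ⟨k, rfl⟩ := Subgroup.mem_closure_singleton.mp hx
    rcases ArtinD.zpow_eq_one_or_self (ArtinD.chiZ_mul_chiZ n) k with hk | hk
    · exact Subgroup.mem_bot.mpr hk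
    · rw [hk] at hinn
      exact absurd hinn (ArtinD.chiZ_notMem_Inn hn)
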